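/- Let $X_1, X_2, \ldots$ be independent, identically distributed random variables taking values in the positive integers with the Lüroth distribution $$P(X_1 = n) = \frac{1}{n(n+1)}, \qquad n \ge 1,$$ and let $S_k = \sum_{i=1}^k X_i$ and $M_k = \max(X_1, \ldots, X_k)$. Then, with probability $1$, $$\lim_{k\to\infty} \frac{S_k - M_k}{k \log k} = 1.$$ -/

import Mathlib

open MeasureTheory ProbabilityTheory Filter Topology

/-- `X 0, X 1, X 2, …` is a sequence of independent random variables on `(Ω, μ)`, each with the
Lüroth distribution `P(X i = n) = 1 / (n (n + 1))`, `n ≥ 1`. These weights sum to `1`, so each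
variable is almost surely a positive integer. -/
structure IsIIDLuroth {Ω : Type*} [MeasurableSpace Ω] (μ : Measure Ω) (X : ℕ → Ω → ℕ) : Prop where
  measurable : ∀ i, Measurable (X i)
  indep : iIndepFun X μ
  law : ∀ i n : ℕ, 1 ≤ n → μ {ω | X i ω = n} = ENNReal.ofReal (1 / ((n : ℝ) * ((n : ℝ) + 1)))

/-- The sum of the first `k` terms of the sequence. -/
def sampleSum {Ω : Type*} (X : ℕ → Ω → ℕ) (k : ℕ) (ω : Ω) : ℕ :=
  ∑ i ∈ Finset.range k, X i ω

/-- The maximum of the first `k` terms of the sequence (`0` for `k = 0`). -/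
def sampleMax {Ω : Type*} (X : ℕ → Ω → ℕ) (k : ℕ) (ω : Ω) : ℕ :=
  (Finset.range k).sup (fun i => X i ω)

/-!
The difference `S_k - M_k` of sum and maximum is nondecreasing in `k`
(`monotone_sampleSum_sub_sampleMax`), so it is enough to prove the limit along sample sizes whose
consecutive ratios tend to `1` (`tendsto_div_of_monotone_of_subseq`). The sizes used are
`k_j = ⌊exp (j ^ (4 / 5))⌋`.

For a sample of size `k`, truncate the terms at the level `t ≈ k (log k) ^ (2 / 3)` and let `Z` be
the sum of the terms that are at most `t`. Since `Z` can exceed the sum without the maximum by at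
most one truncated term, `Z - t ≤ S_k - M_k` always holds (`truncSum_sub_le`). If at most one term
exceeds `t`, that term is the maximum, so `S_k - M_k ≤ Z` (`sampleSum_sub_sampleMax_le`). As `t` is
`o(k log k)`, the limit for `S_k - M_k` follows from the limit for `Z`, provided that two
exceedances occur only finitely often along the sequence.

Both points are consequences of the Borel–Cantelli lemma. A term exceeds `t` with probability
`1 / (t + 1)`, so two of them do with probability at most
`(k / (t + 1)) ^ 2 ≤ (log k) ^ (-4 / 3)` (`measureReal_twoExceed_le`). The variance of `Z` is at
most `k t`, so a deviation of `Z` by `ε k log k` from its mean has probability of the order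
`(log k) ^ (-4 / 3)` as well (`measureReal_truncSum_deviation_le`). With `log k_j ≈ j ^ (4 / 5)`
these bounds are `j ^ (-16 / 15)`, which is summable. The mean of `Z` is `k` times a harmonic sum up
to `t`, hence asymptotic to `k log k` (`tendsto_truncMean_div`).
-/

/-! ### Removing the maximum and truncating -/

section Deterministic

variable {Ω : Type*} (X : ℕ → Ω → ℕ)

/-- The value `n` cut off to `0` above the level `t`. -/
def cutoff (t n : ℕ) : ℝ := if n ≤ t then (n : ℝ) else 0

theorem cutoff_nonneg (t n : ℕ) : 0 ≤ cutoff t n := by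
  unfold cutoff; split_ifs <;> positivity

theorem cutoff_le (t n : ℕ) : cutoff t n ≤ n := by
  unfold cutoff; split_ifs
  · exact le_rfl
  · positivity

theorem cutoff_le_level (t n : ℕ) : cutoff t n ≤ t := by
  unfold cutoff; split_ifs with h
  · exact_mod_cast h
  · positivity

/-- The sum of the first `k` terms, each truncated at the level `t`. -/
def truncSum (t k : ℕ) (ω : Ω) : ℝ := ∑ i ∈ Finset.range k, cutoff t (X i ω)

theorem monotone_sampleSum_sub_sampleMax (ω : Ω) :
    Monotone fun k => (sampleSum X k ω : ℝ) - sampleMax X k ω := by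
  refine monotone_nat_of_le_succ fun k => ?_
  have h : sampleMax X (k + 1) ω ≤ X k ω + sampleMax X k ω := by
    simp only [sampleMax, Finset.range_add_one, Finset.sup_insert]
    exact sup_le (Nat.le_add_right _ _) (Nat.le_add_left _ _)
  have h' : (sampleMax X (k + 1) ω : ℝ) ≤ X k ω + sampleMax X k ω := by exact_mod_cast h
  have hs : (sampleSum X (k + 1) ω : ℝ) = sampleSum X k ω + X k ω := by
    simp [sampleSum, Finset.sum_range_succ]
  linarith

/-- Removing the maximum amounts to omitting one index at which it is attained. -/
theorem exists_sampleSum_sub_sampleMax_eq {k : ℕ} (hk : k ≠ 0) (ω : Ω) :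
    ∃ m ∈ Finset.range k, (∀ i ∈ Finset.range k, X i ω ≤ X m ω) ∧
      (sampleSum X k ω : ℝ) - sampleMax X k ω = ∑ i ∈ (Finset.range k).erase m, (X i ω : ℝ) := by
  obtain ⟨m, hm, h⟩ := Finset.exists_mem_eq_sup (Finset.range k)
    (Finset.nonempty_range_iff.2 hk) (fun i => X i ω)
  refine ⟨m, hm, fun i hi => h ▸ Finset.le_sup (f := fun i => X i ω) hi, ?_⟩
  have hs := Finset.add_sum_erase (Finset.range k) (fun i => (X i ω : ℝ)) hm
  have hM : sampleMax X k ω = X m ω := h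
  simp only [sampleSum, hM, Nat.cast_sum]
  linarith

theorem sampleMax_le_sampleSum (k : ℕ) (ω : Ω) : sampleMax X k ω ≤ sampleSum X k ω :=
  Finset.sup_le fun _ hi => Finset.single_le_sum (f := fun i => X i ω) (fun _ _ => Nat.zero_le _) hi

theorem truncSum_sub_le (t k : ℕ) (ω : Ω) :
    truncSum X t k ω - t ≤ (sampleSum X k ω : ℝ) - sampleMax X k ω := by
  rcases eq_or_ne k 0 with rfl | hk
  · simp [truncSum, sampleSum, sampleMax]
  obtain ⟨m, hm, -, hs⟩ := exists_sampleSum_sub_sampleMax_eq X hk ω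
  have h1 := Finset.add_sum_erase (Finset.range k) (fun i => cutoff t (X i ω)) hm
  have h2 : ∑ i ∈ (Finset.range k).erase m, cutoff t (X i ω)
      ≤ ∑ i ∈ (Finset.range k).erase m, (X i ω : ℝ) :=
    Finset.sum_le_sum fun i _ => cutoff_le _ _
  have h3 := cutoff_le_level t (X m ω)
  rw [hs, truncSum]
  linarith

theorem sampleSum_sub_sampleMax_le {t k : ℕ} {ω : Ω}
    (h : ∀ i < k, ∀ j < k, i ≠ j → ¬ (t < X i ω ∧ t < X j ω)) :
    (sampleSum X k ω : ℝ) - sampleMax X k ω ≤ truncSum X t k ω := by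
  rcases eq_or_ne k 0 with rfl | hk
  · simp [truncSum, sampleSum, sampleMax]
  obtain ⟨m, hm, hmax, hs⟩ := exists_sampleSum_sub_sampleMax_eq X hk ω
  have h1 := Finset.add_sum_erase (Finset.range k) (fun i => cutoff t (X i ω)) hm
  have h2 : ∑ i ∈ (Finset.range k).erase m, cutoff t (X i ω)
      = ∑ i ∈ (Finset.range k).erase m, (X i ω : ℝ) := by
    refine Finset.sum_congr rfl fun i hi => ?_
    obtain ⟨hne, hi⟩ := Finset.mem_erase.1 hi
    have hit : X i ω ≤ t := by
      by_contra! hlt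
      exact h i (Finset.mem_range.1 hi) m (Finset.mem_range.1 hm) hne
        ⟨hlt, hlt.trans_le (hmax i hi)⟩
    simp [cutoff, hit]
  have h3 := cutoff_nonneg t (X m ω)
  rw [hs, truncSum]
  linarith

end Deterministic

/-! ### Moments and tails of the Lüroth distribution -/

section Probability

variable {Ω : Type*} [MeasurableSpace Ω] {μ : Measure Ω} {X : ℕ → Ω → ℕ}

/-- The mean `∑_{n ≤ t} n / (n (n + 1))` of a Lüroth variable truncated at the level `t`. -/
noncomputable def truncMean (t : ℕ) : ℝ := ∑ n ∈ Finset.Icc 1 t, 1 / ((n : ℝ) + 1)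

theorem truncMean_add_one_eq_harmonic (t : ℕ) : truncMean t + 1 = harmonic (t + 1) := by
  induction t with
  | zero => simp [truncMean]
  | succ t ih =>
    rw [harmonic_succ, Rat.cast_add, ← ih, truncMean, truncMean,
      Finset.sum_Icc_succ_top (by omega)]
    push_cast
    ring

theorem measurableSet_eq_value (hX : IsIIDLuroth μ X) (i n : ℕ) :
    MeasurableSet {ω | X i ω = n} :=
  hX.measurable i (measurableSet_singleton n)

theorem measureReal_eq_value (hX : IsIIDLuroth μ X) (i : ℕ) {n : ℕ} (hn : 1 ≤ n) :
    μ.real {ω | X i ω = n} = 1 / ((n : ℝ) * (n + 1)) := by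
  rw [Measure.real, hX.law i n hn, ENNReal.toReal_ofReal (by positivity)]

/-- The expectation of a function of a Lüroth variable that is supported in `{1, …, t}`. -/
theorem integral_comp_eq_sum [IsProbabilityMeasure μ] (hX : IsIIDLuroth μ X) (i t : ℕ)
    (f : ℕ → ℝ) (hf : ∀ n, n ∉ Finset.Icc 1 t → f n = 0) :
    ∫ ω, f (X i ω) ∂μ = ∑ n ∈ Finset.Icc 1 t, f n * (1 / ((n : ℝ) * (n + 1))) := by
  have h : (fun ω => f (X i ω)) =
      fun ω => ∑ n ∈ Finset.Icc 1 t, {ω | X i ω = n}.indicator (fun _ => f n) ω := by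
    funext ω
    simp only [Set.indicator_apply, Set.mem_ofPred_eq, Finset.sum_ite_eq]
    split_ifs with hm
    · rfl
    · exact hf _ hm
  rw [h, integral_finsetSum]
  · refine Finset.sum_congr rfl fun n hn => ?_
    rw [integral_indicator_const _ (measurableSet_eq_value hX i n),
      measureReal_eq_value hX i (Finset.mem_Icc.1 hn).1, smul_eq_mul, mul_comm]
  · intro n _
    exact (integrable_const _).indicator (measurableSet_eq_value hX i n)

theorem cutoff_eq_zero_of_notMem {t n : ℕ} (hn : n ∉ Finset.Icc 1 t) :
    cutoff t n = 0 := by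
  rw [Finset.mem_Icc, not_and_or] at hn
  unfold cutoff
  split_ifs with h
  · have : n = 0 := by omega
    simp [this]
  · rfl

theorem memLp_cutoff [IsProbabilityMeasure μ] (hX : IsIIDLuroth μ X) (t i : ℕ) :
    MemLp (fun ω => cutoff t (X i ω)) 2 μ := by
  refine MemLp.of_bound ((measurable_from_nat (f := cutoff t)).comp
    (hX.measurable i)).aestronglyMeasurable t (ae_of_all _ fun ω => ?_)
  rw [Real.norm_of_nonneg (cutoff_nonneg _ _)]
  exact cutoff_le_level _ _

theorem integral_cutoff [IsProbabilityMeasure μ] (hX : IsIIDLuroth μ X) (t i : ℕ) :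
    ∫ ω, cutoff t (X i ω) ∂μ = truncMean t := by
  rw [integral_comp_eq_sum hX i t _ fun n => cutoff_eq_zero_of_notMem]
  refine Finset.sum_congr rfl fun n hn => ?_
  obtain ⟨h1, h2⟩ := Finset.mem_Icc.1 hn
  have : (0 : ℝ) < n := by exact_mod_cast h1
  rw [cutoff, if_pos h2]
  field_simp

theorem variance_cutoff_le [IsProbabilityMeasure μ] (hX : IsIIDLuroth μ X) (t i : ℕ) :
    Var[fun ω => cutoff t (X i ω); μ] ≤ t := by
  refine (variance_le_expectation_sq (memLp_cutoff hX t i).aestronglyMeasurable).trans ?_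
  have h := integral_comp_eq_sum hX i t (fun n => cutoff t n ^ 2) fun n hn => by
    rw [cutoff_eq_zero_of_notMem hn]; norm_num
  simp only [Pi.pow_apply]
  rw [h]
  calc _ ≤ ∑ n ∈ Finset.Icc 1 t, (1 : ℝ) := by
        refine Finset.sum_le_sum fun n hn => ?_
        obtain ⟨h1, h2⟩ := Finset.mem_Icc.1 hn
        have h0 : (0 : ℝ) < n := by exact_mod_cast h1
        rw [cutoff, if_pos h2, mul_one_div, div_le_one (by positivity)]
        nlinarith
    _ = t := by simp

theorem measureReal_gt_le [IsProbabilityMeasure μ] (hX : IsIIDLuroth μ X) (i t : ℕ) :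
    μ.real {ω | t < X i ω} ≤ 1 / ((t : ℝ) + 1) := by
  have hsum : ∀ t : ℕ, ∑ n ∈ Finset.Icc 1 t, 1 / ((n : ℝ) * (n + 1)) = 1 - 1 / ((t : ℝ) + 1) := by
    intro t
    induction t with
    | zero => simp
    | succ t ih =>
      rw [Finset.sum_Icc_succ_top (by omega), ih]
      push_cast
      field_simp
      ring
  -- `{X i > t}` lies in the complement of `{1 ≤ X i ≤ t}`, whose probability telescopes. The law
  -- is given only on positive integers, so `X i = 0` stays in the complement.
  have hA : MeasurableSet {ω | X i ω ∈ Finset.Icc 1 t} :=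
    hX.measurable i (Finset.measurableSet (Finset.Icc 1 t))
  have h := integral_comp_eq_sum hX i t (fun n => if n ∈ Finset.Icc 1 t then 1 else 0)
    fun n hn => if_neg hn
  have h1 : ∫ ω, (if X i ω ∈ Finset.Icc 1 t then (1 : ℝ) else 0) ∂μ
      = μ.real {ω | X i ω ∈ Finset.Icc 1 t} := by
    rw [← integral_indicator_one hA]
    simp only [Set.indicator_apply, Set.mem_ofPred_eq, Pi.one_apply]
  have h2 : ∑ n ∈ Finset.Icc 1 t, (if n ∈ Finset.Icc 1 t then (1 : ℝ) else 0) *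
      (1 / ((n : ℝ) * (n + 1))) = ∑ n ∈ Finset.Icc 1 t, 1 / ((n : ℝ) * (n + 1)) :=
    Finset.sum_congr rfl fun n hn => by rw [if_pos hn, one_mul]
  have h3 : μ.real {ω | X i ω ∈ Finset.Icc 1 t} = 1 - 1 / ((t : ℝ) + 1) := by
    rw [← h1, h, h2, hsum]
  have h4 : μ.real {ω | t < X i ω} ≤ μ.real {ω | X i ω ∈ Finset.Icc 1 t}ᶜ := by
    refine measureReal_mono fun ω hω => ?_
    simp only [Set.mem_ofPred_eq, Set.mem_compl_iff, Finset.mem_Icc] at hω ⊢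
    omega
  rw [probReal_compl_eq_one_sub hA, h3] at h4
  linarith

/-- The event that two of the first `k` terms exceed the level `t`. -/
def twoExceed (X : ℕ → Ω → ℕ) (t k : ℕ) : Set Ω :=
  {ω | ∃ i < k, ∃ j < k, i ≠ j ∧ t < X i ω ∧ t < X j ω}

theorem measureReal_twoExceed_le [IsProbabilityMeasure μ] (hX : IsIIDLuroth μ X) (t k : ℕ) :
    μ.real (twoExceed X t k) ≤ ((k : ℝ) / (t + 1)) ^ 2 := by
  have hsub : twoExceed X t k ⊆ ⋃ p ∈ (Finset.range k).offDiag,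
      {ω | t < X p.1 ω} ∩ {ω | t < X p.2 ω} := by
    rintro ω ⟨i, hi, j, hj, hij, h⟩
    simp only [Set.mem_iUnion]
    exact ⟨(i, j), by simp [hi, hj, hij], h⟩
  calc μ.real (twoExceed X t k)
      ≤ μ.real (⋃ p ∈ (Finset.range k).offDiag, {ω | t < X p.1 ω} ∩ {ω | t < X p.2 ω}) :=
        measureReal_mono hsub (measure_ne_top _ _)
    _ ≤ ∑ p ∈ (Finset.range k).offDiag, μ.real ({ω | t < X p.1 ω} ∩ {ω | t < X p.2 ω}) :=
        measureReal_biUnion_finset_le _ _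
    _ ≤ ∑ p ∈ (Finset.range k).offDiag, (1 / ((t : ℝ) + 1)) ^ 2 := by
        refine Finset.sum_le_sum fun p hp => ?_
        have hne := (Finset.mem_offDiag.1 hp).2.2
        have hind := (hX.indep.indepFun hne).measure_inter_preimage_eq_mul
          (Set.Ioi t) (Set.Ioi t) measurableSet_Ioi measurableSet_Ioi
        have hreal : μ.real ({ω | t < X p.1 ω} ∩ {ω | t < X p.2 ω})
            = μ.real {ω | t < X p.1 ω} * μ.real {ω | t < X p.2 ω} := by
          rw [Measure.real, Measure.real, Measure.real, ← ENNReal.toReal_mul]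
          exact congrArg ENNReal.toReal hind
        rw [hreal, sq]
        exact mul_le_mul (measureReal_gt_le hX _ _) (measureReal_gt_le hX _ _)
          measureReal_nonneg (by positivity)
    _ ≤ ∑ p ∈ Finset.range k ×ˢ Finset.range k, (1 / ((t : ℝ) + 1)) ^ 2 :=
        Finset.sum_le_sum_of_subset_of_nonneg
          (fun p hp => by simp only [Finset.mem_offDiag, Finset.mem_product] at hp ⊢; tauto)
          fun _ _ _ => by positivity
    _ = ((k : ℝ) / (t + 1)) ^ 2 := by
        rw [Finset.sum_const, Finset.card_product, Finset.card_range, nsmul_eq_mul]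
        push_cast
        ring

/-- Chebyshev's inequality for the truncated sum. -/
theorem measureReal_truncSum_deviation_le [IsProbabilityMeasure μ] (hX : IsIIDLuroth μ X)
    (t k : ℕ) {c : ℝ} (hc : 0 < c) :
    μ.real {ω | c ≤ |truncSum X t k ω - k * truncMean t|} ≤ k * t / c ^ 2 := by
  have heq : truncSum X t k = ∑ i ∈ Finset.range k, fun ω => cutoff t (X i ω) := by
    funext ω; simp [truncSum]
  have hL : MemLp (truncSum X t k) 2 μ := by
    rw [heq]; exact memLp_finsetSum' _ fun i _ => memLp_cutoff hX t i
  have hmean : μ[truncSum X t k] = k * truncMean t := by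
    simp only [truncSum]
    rw [integral_finsetSum _ fun i _ => (memLp_cutoff hX t i).integrable (by norm_num)]
    simp [integral_cutoff hX]
  have hvar : Var[truncSum X t k; μ] ≤ k * t := by
    rw [heq, IndepFun.variance_sum (fun i _ => memLp_cutoff hX t i)]
    · exact (Finset.sum_le_sum fun i _ => variance_cutoff_le hX t i).trans (by simp)
    · intro i _ j _ hij
      exact (hX.indep.indepFun hij).comp (φ := cutoff t) (ψ := cutoff t)
        measurable_from_nat measurable_from_nat
  have h := meas_ge_le_variance_div_sq hL hc
  rw [hmean] at h
  refine (ENNReal.toReal_le_of_le_ofReal ?_ h).trans ?_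
  · exact div_nonneg (variance_nonneg _ _) (by positivity)
  · gcongr

end Probability

/-! ### Interpolation along a subsequence -/

/-- If a sequence of indices tends to infinity, then every large `k` is bracketed between two
consecutive members with large position. No monotonicity of the sequence is required. -/
theorem eventually_exists_le_lt_succ {n : ℕ → ℕ} (hn : Tendsto n atTop atTop) (J : ℕ) :
    ∀ᶠ k in atTop, ∃ j ≥ J, n j ≤ k ∧ k < n (j + 1) := by
  filter_upwards [eventually_ge_atTop (n J)] with k hk
  have hex : ∃ i, k < n (J + i + 1) := by
    obtain ⟨i, hJ, hi⟩ := ((eventually_ge_atTop (J + 1)).and (hn.eventually_gt_atTop k)).exists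
    exact ⟨i - J - 1, by rwa [show J + (i - J - 1) + 1 = i by omega]⟩
  classical
  refine ⟨J + Nat.find hex, by omega, ?_, Nat.find_spec hex⟩
  rcases h : Nat.find hex with _ | i
  · simpa using hk
  · exact not_lt.1 (Nat.find_min hex (m := i) (by omega))

theorem tendsto_div_of_monotone_of_subseq {u g : ℕ → ℝ} (hu : Monotone u) (hu0 : ∀ k, 0 ≤ u k)
    (hg : Monotone g) (hgpos : ∀ᶠ k in atTop, 0 < g k) {n : ℕ → ℕ} (hn : Tendsto n atTop atTop)
    (hratio : Tendsto (fun j => g (n (j + 1)) / g (n j)) atTop (𝓝 1))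
    (hlim : Tendsto (fun j => u (n j) / g (n j)) atTop (𝓝 1)) :
    Tendsto (fun k => u k / g k) atTop (𝓝 1) := by
  have hpos : ∀ᶠ j in atTop, 0 < g (n j) := hn.eventually hgpos
  have hpos' : ∀ᶠ j in atTop, 0 < g (n (j + 1)) := (tendsto_add_atTop_nat 1).eventually hpos
  have hlow : Tendsto (fun j => u (n j) / g (n (j + 1))) atTop (𝓝 1) := by
    have h := hlim.div hratio one_ne_zero
    rw [div_one] at h
    refine h.congr' ?_
    filter_upwards [hpos, hpos'] with j h1 h2
    simp only [Pi.div_apply]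
    field_simp
  have hup : Tendsto (fun j => u (n (j + 1)) / g (n j)) atTop (𝓝 1) := by
    have h := (hlim.comp (tendsto_add_atTop_nat 1)).mul hratio
    rw [mul_one] at h
    refine h.congr' ?_
    filter_upwards [hpos, hpos'] with j h1 h2
    simp only [Function.comp_apply]
    field_simp
  refine tendsto_order.2 ⟨fun a ha => ?_, fun a ha => ?_⟩
  · obtain ⟨J, hJ⟩ := eventually_atTop.1 ((hlow.eventually_const_lt ha).and hpos)
    filter_upwards [eventually_exists_le_lt_succ hn J] with k ⟨j, hj, h1, h2⟩
    obtain ⟨h3, h4⟩ := hJ j hj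
    refine h3.trans_le (div_le_div₀ (hu0 _) (hu h1) (h4.trans_le (hg h1)) (hg h2.le))
  · obtain ⟨J, hJ⟩ := eventually_atTop.1 ((hup.eventually_lt_const ha).and hpos)
    filter_upwards [eventually_exists_le_lt_succ hn J] with k ⟨j, hj, h1, h2⟩
    obtain ⟨h3, h4⟩ := hJ j hj
    exact (div_le_div₀ (hu0 _) (hu h2.le) h4 (hg h1)).trans_lt h3

theorem monotone_natCast_mul_log : Monotone fun k : ℕ => (k : ℝ) * Real.log k := by
  intro a b hab
  rcases Nat.eq_zero_or_pos a with rfl | ha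
  · simpa using mul_nonneg (Nat.cast_nonneg b) (Real.log_natCast_nonneg b)
  · have h0 : (0 : ℝ) < a := by exact_mod_cast ha
    have h1 : (a : ℝ) ≤ b := by exact_mod_cast hab
    exact mul_le_mul h1 (Real.log_le_log h0 h1) (Real.log_natCast_nonneg a) (Nat.cast_nonneg b)

/-! ### Sample sizes and truncation levels -/

/-- The logarithm of the `j`-th sample size. The exponent is below `1`, so that the ratio of
consecutive sample sizes tends to `1`, and above `3 / 4`, so that `logScale j ^ (-4 / 3)` is
summable. -/
noncomputable def logScale (j : ℕ) : ℝ := (j : ℝ) ^ (4 / 5 : ℝ)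

/-- The sample sizes along which the limit is first proved. -/
noncomputable def sampleSize (j : ℕ) : ℕ := ⌊Real.exp (logScale j)⌋₊

/-- The truncation level `k (log k) ^ (2 / 3)` for samples of size `k = exp (logScale j)`. The
exponent `2 / 3` gives the probability of two exceedances and the relative variance of the
truncated sum the same order `(log k) ^ (-4 / 3)`. -/
noncomputable def truncLevel (j : ℕ) : ℕ :=
  ⌊Real.exp (logScale j) * logScale j ^ (2 / 3 : ℝ)⌋₊

theorem tendsto_logScale : Tendsto logScale atTop atTop :=
  (tendsto_rpow_atTop (by norm_num)).comp tendsto_natCast_atTop_atTop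

theorem logScale_nonneg (j : ℕ) : 0 ≤ logScale j := by unfold logScale; positivity

theorem eventually_one_le_logScale : ∀ᶠ j in atTop, 1 ≤ logScale j :=
  tendsto_logScale.eventually_ge_atTop 1

theorem tendsto_exp_logScale : Tendsto (fun j => Real.exp (logScale j)) atTop atTop :=
  Real.tendsto_exp_atTop.comp tendsto_logScale

theorem tendsto_logScale_succ_sub :
    Tendsto (fun j => logScale (j + 1) - logScale j) atTop (𝓝 0) := by
  have hup : Tendsto (fun j : ℕ => (4 / 5 : ℝ) * (j : ℝ) ^ (-(1 / 5) : ℝ)) atTop (𝓝 0) := by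
    simpa using ((tendsto_rpow_neg_atTop (y := 1 / 5) (by norm_num)).comp
      tendsto_natCast_atTop_atTop).const_mul (4 / 5 : ℝ)
  refine tendsto_of_tendsto_of_tendsto_of_le_of_le' tendsto_const_nhds hup
    (Eventually.of_forall fun j => ?_) ?_
  · rw [sub_nonneg]
    exact Real.rpow_le_rpow (by positivity) (by push_cast; linarith) (by norm_num)
  · filter_upwards [eventually_ge_atTop 1] with j hj
    have h0 : (0 : ℝ) < j := by exact_mod_cast hj
    have hb := rpow_one_add_le_one_add_mul_self (s := 1 / (j : ℝ)) (p := 4 / 5)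
      (by have : 0 ≤ 1 / (j : ℝ) := by positivity
          linarith) (by norm_num) (by norm_num)
    have heq : logScale (j + 1) = logScale j * (1 + 1 / (j : ℝ)) ^ (4 / 5 : ℝ) := by
      rw [logScale, logScale, ← Real.mul_rpow (by positivity) (by positivity)]
      congr 1
      push_cast
      field_simp
    have hexp : (j : ℝ) ^ (-(1 / 5) : ℝ) = logScale j * (1 / (j : ℝ)) := by
      rw [logScale, one_div (j : ℝ), ← Real.rpow_neg_one, ← Real.rpow_add h0]
      norm_num
    rw [heq, hexp]
    nlinarith [mul_le_mul_of_nonneg_left hb (logScale_nonneg j)]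

theorem summable_logScale_rpow : Summable fun j => logScale j ^ (-(4 / 3) : ℝ) := by
  have h := Real.summable_nat_rpow_inv (p := 16 / 15) |>.2 (by norm_num)
  refine h.congr fun j => ?_
  rw [logScale, ← Real.rpow_mul (by positivity), ← Real.rpow_neg (by positivity)]
  norm_num

theorem tendsto_sampleSize : Tendsto sampleSize atTop atTop :=
  tendsto_nat_floor_atTop.comp tendsto_exp_logScale

theorem tendsto_sampleSize_div :
    Tendsto (fun j => (sampleSize j : ℝ) / Real.exp (logScale j)) atTop (𝓝 1) :=
  tendsto_nat_floor_div_atTop.comp tendsto_exp_logScale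

theorem tendsto_log_sampleSize_div :
    Tendsto (fun j => Real.log (sampleSize j) / logScale j) atTop (𝓝 1) := by
  have h1 := (tendsto_sampleSize_div.log one_ne_zero).div_atTop tendsto_logScale
  have h2 := h1.const_add 1
  rw [add_zero] at h2
  refine h2.congr' ?_
  filter_upwards [eventually_one_le_logScale, tendsto_sampleSize.eventually_ge_atTop 1]
    with j hL hn
  have h0 : (sampleSize j : ℝ) ≠ 0 := by positivity
  rw [Real.log_div h0 (Real.exp_ne_zero _), Real.log_exp]
  field_simp
  ring

/-- The normalization `k log k` along the sample sizes. -/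
theorem tendsto_sampleSize_mul_log_div :
    Tendsto (fun j => (sampleSize j : ℝ) * Real.log (sampleSize j) /
      (Real.exp (logScale j) * logScale j)) atTop (𝓝 1) := by
  have h := tendsto_sampleSize_div.mul tendsto_log_sampleSize_div
  rw [mul_one] at h
  exact h.congr fun j => div_mul_div_comm _ _ _ _

theorem tendsto_scale_succ_div :
    Tendsto (fun j => Real.exp (logScale (j + 1)) * logScale (j + 1) /
      (Real.exp (logScale j) * logScale j)) atTop (𝓝 1) := by
  have h1 := (Real.continuous_exp.tendsto 0).comp tendsto_logScale_succ_sub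
  have h2 := (tendsto_logScale_succ_sub.div_atTop tendsto_logScale).const_add 1
  have h := h1.mul h2
  rw [Real.exp_zero, add_zero, mul_one] at h
  refine h.congr' ?_
  filter_upwards [eventually_one_le_logScale] with j hL
  simp only [Function.comp_apply, Real.exp_sub]
  field_simp
  ring

theorem tendsto_sampleSize_mul_log_ratio :
    Tendsto (fun j => (sampleSize (j + 1) : ℝ) * Real.log (sampleSize (j + 1)) /
      ((sampleSize j : ℝ) * Real.log (sampleSize j))) atTop (𝓝 1) := by
  have h := ((tendsto_sampleSize_mul_log_div.comp (tendsto_add_atTop_nat 1)).mul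
    tendsto_scale_succ_div).div tendsto_sampleSize_mul_log_div one_ne_zero
  simp only [mul_one, div_one] at h
  refine h.congr' ?_
  filter_upwards [eventually_one_le_logScale,
    (tendsto_add_atTop_nat 1).eventually eventually_one_le_logScale] with j h1 h2
  simp only [Pi.div_apply, Function.comp_apply]
  rw [div_mul_div_cancel₀ (by positivity), div_div_div_cancel_right₀ (by positivity)]

theorem truncLevel_le (j : ℕ) :
    (truncLevel j : ℝ) ≤ Real.exp (logScale j) * logScale j ^ (2 / 3 : ℝ) :=
  Nat.floor_le (mul_nonneg (Real.exp_pos _).le (Real.rpow_nonneg (logScale_nonneg j) _))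

theorem lt_truncLevel_add_one (j : ℕ) :
    Real.exp (logScale j) * logScale j ^ (2 / 3 : ℝ) < truncLevel j + 1 :=
  Nat.lt_floor_add_one _

theorem sampleSize_le (j : ℕ) : (sampleSize j : ℝ) ≤ Real.exp (logScale j) :=
  Nat.floor_le (Real.exp_pos _).le

theorem tendsto_truncLevel_div :
    Tendsto (fun j => (truncLevel j : ℝ) / (Real.exp (logScale j) * logScale j))
      atTop (𝓝 0) := by
  have hup : Tendsto (fun j => logScale j ^ (-(1 / 3) : ℝ)) atTop (𝓝 0) :=
    (tendsto_rpow_neg_atTop (by norm_num)).comp tendsto_logScale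
  refine tendsto_of_tendsto_of_tendsto_of_le_of_le' tendsto_const_nhds hup
    (Eventually.of_forall fun j => ?_) ?_
  · exact div_nonneg (Nat.cast_nonneg _) (mul_nonneg (Real.exp_pos _).le (logScale_nonneg j))
  · filter_upwards [eventually_one_le_logScale] with j hL
    have h0 : 0 < logScale j := by linarith
    rw [div_le_iff₀ (by positivity)]
    refine (truncLevel_le j).trans_eq ?_
    rw [show (2 / 3 : ℝ) = -(1 / 3) + 1 by norm_num, Real.rpow_add_one h0.ne']
    ring

theorem sq_sampleSize_div_truncLevel_le {j : ℕ} (hL : 1 ≤ logScale j) :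
    ((sampleSize j : ℝ) / (truncLevel j + 1)) ^ 2 ≤ logScale j ^ (-(4 / 3) : ℝ) := by
  have h0 : 0 < logScale j := by linarith
  have h : (sampleSize j : ℝ) / (truncLevel j + 1) ≤ logScale j ^ (-(2 / 3) : ℝ) := by
    rw [div_le_iff₀ (by positivity), Real.rpow_neg h0.le, ← div_eq_inv_mul,
      le_div_iff₀ (by positivity)]
    calc _ ≤ Real.exp (logScale j) * logScale j ^ (2 / 3 : ℝ) := by
          gcongr; exact sampleSize_le j
      _ ≤ _ := (lt_truncLevel_add_one j).le
  calc _ ≤ (logScale j ^ (-(2 / 3) : ℝ)) ^ 2 := by gcongr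
    _ = _ := by
      rw [← Real.rpow_natCast, ← Real.rpow_mul h0.le]
      norm_num

theorem sampleSize_mul_truncLevel_div_sq_le {j : ℕ} (hL : 1 ≤ logScale j) {ε : ℝ} (hε : 0 < ε) :
    (sampleSize j : ℝ) * truncLevel j / (ε * (Real.exp (logScale j) * logScale j)) ^ 2
      ≤ (ε ^ 2)⁻¹ * logScale j ^ (-(4 / 3) : ℝ) := by
  have h0 : 0 < logScale j := by linarith
  rw [div_le_iff₀ (by positivity)]
  calc (sampleSize j : ℝ) * truncLevel j
      ≤ Real.exp (logScale j) * (Real.exp (logScale j) * logScale j ^ (2 / 3 : ℝ)) :=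
        mul_le_mul (sampleSize_le j) (truncLevel_le j) (by positivity) (by positivity)
    _ = _ := by
      have h : logScale j ^ (2 / 3 : ℝ) = logScale j ^ (-(4 / 3) : ℝ) * logScale j ^ 2 := by
        rw [← Real.rpow_natCast, ← Real.rpow_add h0]
        norm_num
      rw [h]
      field_simp

/-- The truncated mean is asymptotic to the logarithm of the sample size: the truncation level
differs from the sample size only by a power of the logarithm. -/
theorem tendsto_truncMean_div :
    Tendsto (fun j => truncMean (truncLevel j) / logScale j) atTop (𝓝 1) := by
  have hinv : Tendsto (fun j => 1 / logScale j) atTop (𝓝 0) :=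
    tendsto_const_nhds.div_atTop tendsto_logScale
  have hlog : Tendsto (fun j => Real.log (logScale j) / logScale j) atTop (𝓝 0) :=
    (Real.isLittleO_log_id_atTop.tendsto_div_nhds_zero).comp tendsto_logScale
  have hlow : Tendsto (fun j => 1 - 1 / logScale j) atTop (𝓝 1) := by
    simpa using hinv.const_sub 1
  have hup : Tendsto (fun j => 1 + Real.log 2 * (1 / logScale j)
      + 2 / 3 * (Real.log (logScale j) / logScale j)) atTop (𝓝 1) := by
    simpa using ((hinv.const_mul (Real.log 2)).const_add 1).add (hlog.const_mul (2 / 3))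
  refine tendsto_of_tendsto_of_tendsto_of_le_of_le' hlow hup ?_ ?_
  all_goals
    filter_upwards [eventually_one_le_logScale] with j hL
    have h0 : 0 < logScale j := by linarith
    have hharm := truncMean_add_one_eq_harmonic (truncLevel j)
    have hpow : 1 ≤ logScale j ^ (2 / 3 : ℝ) := Real.one_le_rpow hL (by norm_num)
    have hE := Real.exp_pos (logScale j)
  · have h1 := log_add_one_le_harmonic (truncLevel j + 1)
    have h2 : logScale j ≤ Real.log ↑(truncLevel j + 1 + 1) := by
      rw [Real.le_log_iff_exp_le (by positivity)]
      have := lt_truncLevel_add_one j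
      push_cast
      nlinarith
    rw [le_div_iff₀ h0, sub_mul, one_div_mul_cancel h0.ne']
    linarith
  · have h1 := harmonic_le_one_add_log (truncLevel j + 1)
    have h2 : Real.log ↑(truncLevel j + 1) ≤
        Real.log 2 + logScale j + 2 / 3 * Real.log (logScale j) := by
      have h3 : ((truncLevel j + 1 : ℕ) : ℝ)
          ≤ 2 * Real.exp (logScale j) * logScale j ^ (2 / 3 : ℝ) := by
        have := truncLevel_le j
        have := Real.one_le_exp h0.le
        push_cast
        nlinarith
      refine (Real.log_le_log (by positivity) h3).trans_eq ?_
      rw [Real.log_mul (by positivity) (by positivity), Real.log_mul (by norm_num) hE.ne',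
        Real.log_exp, Real.log_rpow h0]
    rw [div_le_iff₀ h0]
    have h4 : (1 + Real.log 2 * (1 / logScale j) + 2 / 3 * (Real.log (logScale j) / logScale j))
        * logScale j = Real.log 2 + logScale j + 2 / 3 * Real.log (logScale j) := by
      field_simp
      ring
    linarith

/-! ### Almost sure convergence -/

section AlmostSure

variable {Ω : Type*} [MeasurableSpace Ω] {μ : Measure Ω} {X : ℕ → Ω → ℕ}

/-- Borel–Cantelli with real-valued probabilities bounded eventually by a summable sequence. -/
theorem ae_eventually_notMem_of_measureReal_le [IsProbabilityMeasure μ] {s : ℕ → Set Ω}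
    {b : ℕ → ℝ} (hb : Summable b) (h : ∀ᶠ j in atTop, μ.real (s j) ≤ b j) :
    ∀ᵐ ω ∂μ, ∀ᶠ j in atTop, ω ∉ s j := by
  refine ae_eventually_notMem ?_
  have hs : Summable fun j => μ.real (s j) :=
    summable_of_isBigO_nat hb (Asymptotics.IsBigO.of_bound 1 (h.mono fun j hj => by
      rw [Real.norm_of_nonneg measureReal_nonneg, one_mul]
      exact hj.trans (le_abs_self _)))
  have := hs.tsum_ofReal_ne_top
  have heq : ∀ j, ENNReal.ofReal (μ.real (s j)) = μ (s j) := fun j => ofReal_measureReal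
  simpa only [heq] using this

theorem ae_eventually_notMem_twoExceed [IsProbabilityMeasure μ] (hX : IsIIDLuroth μ X) :
    ∀ᵐ ω ∂μ, ∀ᶠ j in atTop, ω ∉ twoExceed X (truncLevel j) (sampleSize j) := by
  refine ae_eventually_notMem_of_measureReal_le summable_logScale_rpow ?_
  filter_upwards [eventually_one_le_logScale] with j hL
  exact (measureReal_twoExceed_le hX _ _).trans (sq_sampleSize_div_truncLevel_le hL)

theorem ae_tendsto_truncSum_div [IsProbabilityMeasure μ] (hX : IsIIDLuroth μ X) :
    ∀ᵐ ω ∂μ, Tendsto (fun j => truncSum X (truncLevel j) (sampleSize j) ω /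
      (Real.exp (logScale j) * logScale j)) atTop (𝓝 1) := by
  have hdev : ∀ᵐ ω ∂μ, ∀ m : ℕ, ∀ᶠ j in atTop,
      ω ∉ {ω | 1 / ((m : ℝ) + 1) * (Real.exp (logScale j) * logScale j) ≤
        |truncSum X (truncLevel j) (sampleSize j) ω - sampleSize j * truncMean (truncLevel j)|} := by
    refine ae_all_iff.2 fun m => ae_eventually_notMem_of_measureReal_le
      (summable_logScale_rpow.mul_left (((1 / ((m : ℝ) + 1)) ^ 2)⁻¹)) ?_
    filter_upwards [eventually_one_le_logScale] with j hL
    have h0 : 0 < logScale j := by linarith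
    exact (measureReal_truncSum_deviation_le hX _ _ (by positivity)).trans
      (sampleSize_mul_truncLevel_div_sq_le hL (by positivity))
  have hmean := tendsto_sampleSize_div.mul tendsto_truncMean_div
  rw [mul_one] at hmean
  filter_upwards [hdev] with ω hω
  have hzero : Tendsto (fun j => (truncSum X (truncLevel j) (sampleSize j) ω -
      sampleSize j * truncMean (truncLevel j)) / (Real.exp (logScale j) * logScale j))
      atTop (𝓝 0) := by
    rw [Metric.tendsto_nhds]
    intro ε hε
    obtain ⟨m, hm⟩ := exists_nat_one_div_lt hε
    filter_upwards [hω m, eventually_one_le_logScale] with j hj hL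
    have h0 : 0 < logScale j := by linarith
    simp only [not_le] at hj
    rw [Real.dist_eq, sub_zero, abs_div, abs_of_pos (a := Real.exp (logScale j) * logScale j)
      (by positivity), div_lt_iff₀ (by positivity)]
    exact hj.trans (by gcongr)
  have h := hzero.add hmean
  rw [zero_add] at h
  refine h.congr fun j => ?_
  rw [div_mul_div_comm, ← add_div, sub_add_cancel]

theorem ae_tendsto_subseq [IsProbabilityMeasure μ] (hX : IsIIDLuroth μ X) :
    ∀ᵐ ω ∂μ, Tendsto (fun j => ((sampleSum X (sampleSize j) ω : ℝ) -
      sampleMax X (sampleSize j) ω) / ((sampleSize j : ℝ) * Real.log (sampleSize j)))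
      atTop (𝓝 1) := by
  filter_upwards [ae_eventually_notMem_twoExceed hX, ae_tendsto_truncSum_div hX] with ω h2 hZ
  have hlow := hZ.sub tendsto_truncLevel_div
  rw [sub_zero] at hlow
  have hscale : ∀ j, 0 ≤ Real.exp (logScale j) * logScale j := fun j =>
    mul_nonneg (Real.exp_pos _).le (logScale_nonneg j)
  have hD : Tendsto (fun j => ((sampleSum X (sampleSize j) ω : ℝ) -
      sampleMax X (sampleSize j) ω) / (Real.exp (logScale j) * logScale j)) atTop (𝓝 1) := by
    refine tendsto_of_tendsto_of_tendsto_of_le_of_le' hlow hZ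
      (Eventually.of_forall fun j => ?_) ?_
    · rw [← sub_div]
      exact div_le_div_of_nonneg_right (truncSum_sub_le X _ _ ω) (hscale j)
    · filter_upwards [h2] with j hj
      refine div_le_div_of_nonneg_right (sampleSum_sub_sampleMax_le X ?_) (hscale j)
      exact fun a ha b hb hab h => hj ⟨a, ha, b, hb, hab, h⟩
  have h := hD.div tendsto_sampleSize_mul_log_div one_ne_zero
  rw [div_one] at h
  refine h.congr' ?_
  filter_upwards [eventually_one_le_logScale] with j hL
  exact div_div_div_cancel_right₀ (by positivity) _ _

end AlmostSure

theorem theorem3 {Ω : Type*} [MeasurableSpace Ω] (μ : Measure Ω) [IsProbabilityMeasure μ]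
    (X : ℕ → Ω → ℕ) (hX : IsIIDLuroth μ X) :
    ∀ᵐ ω ∂μ, Tendsto
      (fun k : ℕ => ((sampleSum X k ω : ℝ) - (sampleMax X k ω : ℝ)) / ((k : ℝ) * Real.log (k : ℝ)))
      atTop (𝓝 1) := by
  filter_upwards [ae_tendsto_subseq hX] with ω hω
  refine tendsto_div_of_monotone_of_subseq (monotone_sampleSum_sub_sampleMax X ω)
    (fun k => ?_) monotone_natCast_mul_log ?_ tendsto_sampleSize
    tendsto_sampleSize_mul_log_ratio hω
  · rw [sub_nonneg]
    exact_mod_cast sampleMax_le_sampleSum X k ω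
  · filter_upwards [eventually_ge_atTop 2] with k hk
    have h1 : (1 : ℝ) < k := by exact_mod_cast hk
    exact mul_pos (by linarith) (Real.log_pos h1)
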